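/- Let $\mathbb{K}$ be a field, $d\ge 0$ an integer, and $\mathcal{A}$ a $\mathbb{K}$-algebra isomorphic to $\mathrm{Mat}_{d+1}(\mathbb{K})$. An element of $\mathcal{A}$ is multiplicity-free if it has $d+1$ distinct eigenvalues in $\mathbb{K}$; the primitive idempotents of such an element $X$ with eigenvalues $\theta_0,\dots,\theta_d$ are $\prod_{j\ne i}\frac{X-\theta_jI}{\theta_i-\theta_j}$ $(0\le i\le d)$. A Leonard system in $\mathcal{A}$ is a sequence $\Phi=(A;\{E_i\}_{i=0}^d;A^*;\{E^*_i\}_{i=0}^d)$ such that $A,A^*\in\mathcal{A}$ are multiplicity-free, $E_0,\dots,E_d$ (resp. $E^*_0,\dots,E^*_d$) is an ordering of the primitive idempotents of $A$ (resp. $A^*$), and for $0\le i,j\le d$ each of $E_iA^*E_j$ and $E^*_iAE^*_j$ is zero if $|i-j|>1$ and nonzero if $|i-j|=1$. Let $V$ be a simple $\mathcal{A}$-module, and let tr denote the trace of the action of an element of $\mathcal{A}$ on $V$. Let $\theta_i$ (resp. $\theta^*_i$) be the eigenvalue of $A$ (resp. $A^*$) associated with $E_i$ (resp. $E^*_i$).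 A first split sequence of $\Phi$ is a sequence $\varphi_1,\dots,\varphi_d$ in $\mathbb{K}$ for which $V$ has a basis $u_0,\dots,u_d$ with $Au_i=\theta_iu_i+u_{i+1}$ $(0\le i\le d-1)$, $Au_d=\theta_du_d$, $A^*u_i=\varphi_iu_{i-1}+\theta^*_iu_i$ $(1\le i\le d)$, $A^*u_0=\theta^*_0u_0$. A second split sequence $\phi_1,\dots,\phi_d$ of $\Phi$ is a first split sequence of the Leonard system $\Phi^{\Downarrow}=(A;\{E_{d-i}\}_{i=0}^d;A^*;\{E^*_i\}_{i=0}^d)$. A parameter array of $\Phi$ is $(\{\theta_i\}_{i=0}^d;\{\theta^*_i\}_{i=0}^d;\{\varphi_i\}_{i=1}^d;\{\phi_i\}_{i=1}^d)$. For $0\le i\le d$ define polynomials $$\tau_i=\prod_{h=0}^{i-1}(\lambda-\theta_h),\quad \eta_i=\prod_{h=0}^{i-1}(\lambda-\theta_{d-h}),\quad \tau^*_i=\prod_{h=0}^{i-1}(\lambda-\theta^*_h),\quad \eta^*_i=\prod_{h=0}^{i-1}(\lambda-\theta^*_{d-h}).$$ **Theorem.** Every Leonard system $\Phi$ has exactly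 one parameter array, and for $1\le i\le d$ all the denominators below are nonzero and $$\varphi_i=(\theta^*_0-\theta^*_i)\frac{\mathrm{tr}(\tau_i(A)E^*_0)}{\mathrm{tr}(\tau_{i-1}(A)E^*_0)},\qquad \varphi_i=(\theta^*_d-\theta^*_{i-1})\frac{\mathrm{tr}(\eta_{d-i+1}(A)E^*_d)}{\mathrm{tr}(\eta_{d-i}(A)E^*_d)},$$ $$\varphi_i=(\theta_0-\theta_i)\frac{\mathrm{tr}(\tau^*_i(A^*)E_0)}{\mathrm{tr}(\tau^*_{i-1}(A^*)E_0)},\qquad \varphi_i=(\theta_d-\theta_{i-1})\frac{\mathrm{tr}(\eta^*_{d-i+1}(A^*)E_d)}{\mathrm{tr}(\eta^*_{d-i}(A^*)E_d)},$$ $$\phi_i=(\theta^*_0-\theta^*_i)\frac{\mathrm{tr}(\eta_i(A)E^*_0)}{\mathrm{tr}(\eta_{i-1}(A)E^*_0)},\qquad \phi_i=(\theta^*_d-\theta^*_{i-1})\frac{\mathrm{tr}(\tau_{d-i+1}(A)E^*_d)}{\mathrm{tr}(\tau_{d-i}(A)E^*_d)},$$ $$\phi_i=(\theta_0-\theta_{d-i+1})\frac{\mathrm{tr}(\eta^*_{d-i+1}(A^*)E_0)}{\mathrm{tr}(\eta^*_{d-i}(A^*)E_0)},\qquad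 \phi_i=(\theta_d-\theta_{d-i})\frac{\mathrm{tr}(\tau^*_i(A^*)E_d)}{\mathrm{tr}(\tau^*_{i-1}(A^*)E_d)}.$$ -/

import Mathlib

open Polynomial

section Leonard

variable {K : Type*} [Field K] {𝒜 : Type*} [Ring 𝒜] [Algebra K 𝒜] {d : ℕ}

/-- In an algebra isomorphic to `Mat_{d+1}(K)` the eigenvalues of `X` in `K` are the points of
`spectrum K X`; `X` is multiplicity-free when there are `d + 1` of them. -/
def IsMultiplicityFree (K : Type*) [Field K] {𝒜 : Type*} [Ring 𝒜] [Algebra K 𝒜] (d : ℕ)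
    (X : 𝒜) : Prop :=
  (spectrum K X).ncard = d + 1

/-- `θ_0, …, θ_d` is an ordering of the eigenvalues of `X`. -/
def IsEigenvalueOrdering (X : 𝒜) (θ : Fin (d + 1) → K) : Prop :=
  Function.Injective θ ∧ Set.range θ = spectrum K X

/-- `∏_{j ≠ i} (X - θ_j) / (θ_i - θ_j)`. -/
noncomputable def primitiveIdempotent (X : 𝒜) (θ : Fin (d + 1) → K) (i : Fin (d + 1)) : 𝒜 :=
  aeval X (∏ j ∈ Finset.univ.erase i,
    (C ((θ i - θ j)⁻¹) * ((Polynomial.X : K[X]) - C (θ j))))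

/-- `θ_0, …, θ_d` is an ordering of the eigenvalues of `X`, and `E_i` is the primitive idempotent
of `X` associated with `θ_i`, for all `i`. -/
def IsIdempotentOrdering (X : 𝒜) (θ : Fin (d + 1) → K) (E : Fin (d + 1) → 𝒜) : Prop :=
  IsEigenvalueOrdering X θ ∧ ∀ i, E i = primitiveIdempotent X θ i

/-- A Leonard system `(A; {E_i}; A*; {E*_i})` in `𝒜`. The algebra `𝒜` is meant to be isomorphic to
`Mat_{d+1}(K)`. -/
structure LeonardSystem (K : Type*) [Field K] (𝒜 : Type*) [Ring 𝒜] [Algebra K 𝒜] (d : ℕ) where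
  A : 𝒜
  E : Fin (d + 1) → 𝒜
  Astar : 𝒜
  Estar : Fin (d + 1) → 𝒜
  multiplicityFree_A : IsMultiplicityFree K d A
  multiplicityFree_Astar : IsMultiplicityFree K d Astar
  ordering_E : ∃ θ : Fin (d + 1) → K, IsIdempotentOrdering A θ E
  ordering_Estar : ∃ θstar : Fin (d + 1) → K, IsIdempotentOrdering Astar θstar Estar
  E_Astar_E_eq_zero : ∀ i j : Fin (d + 1), 1 < |(i : ℤ) - (j : ℤ)| → E i * Astar * E j = 0
  E_Astar_E_ne_zero : ∀ i j : Fin (d + 1), |(i : ℤ) - (j : ℤ)| = 1 → E i * Astar * E j ≠ 0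
  Estar_A_Estar_eq_zero : ∀ i j : Fin (d + 1), 1 < |(i : ℤ) - (j : ℤ)| →
    Estar i * A * Estar j = 0
  Estar_A_Estar_ne_zero : ∀ i j : Fin (d + 1), |(i : ℤ) - (j : ℤ)| = 1 →
    Estar i * A * Estar j ≠ 0

theorem abs_rev_sub_rev (i j : Fin (d + 1)) :
    |((i.rev : Fin (d + 1)) : ℤ) - ((j.rev : Fin (d + 1)) : ℤ)| = |(i : ℤ) - (j : ℤ)| := by
  have h1 : ((i.rev : Fin (d + 1)) : ℤ) = d - i := by
    have := i.is_lt
    rw [Fin.val_rev]; omega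
  have h2 : ((j.rev : Fin (d + 1)) : ℤ) = d - j := by
    have := j.is_lt
    rw [Fin.val_rev]; omega
  rw [h1, h2, abs_sub_comm (i : ℤ)]
  congr 1; ring

theorem IsIdempotentOrdering.rev {X : 𝒜} {θ : Fin (d + 1) → K} {E : Fin (d + 1) → 𝒜}
    (h : IsIdempotentOrdering X θ E) :
    IsIdempotentOrdering X (fun i => θ i.rev) (fun i => E i.rev) := by
  refine ⟨⟨fun i j hij => Fin.rev_injective (h.1.1 hij), ?_⟩, fun i => ?_⟩
  · rw [← h.1.2]
    exact Fin.rev_surjective.range_comp θ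
  · change E i.rev = _
    rw [h.2, primitiveIdempotent, primitiveIdempotent]
    congr 1
    refine Finset.prod_bij' (fun j _ => j.rev) (fun j _ => j.rev) ?_ ?_ ?_ ?_ ?_
    · intro j hj
      simp only [Finset.mem_erase, Finset.mem_univ, and_true] at hj ⊢
      exact fun h' => hj (by rw [← h', Fin.rev_rev])
    · intro j hj
      simp only [Finset.mem_erase, Finset.mem_univ, and_true] at hj ⊢
      exact fun h' => hj (Fin.rev_injective h')
    · intro j _; exact Fin.rev_rev j
    · intro j _; exact Fin.rev_rev j
    · intro j _; simp only [Fin.rev_rev]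

namespace LeonardSystem

/-- The relative `Φ^⇓ = (A; {E_{d-i}}; A*; {E*_i})`. -/
def Down (Φ : LeonardSystem K 𝒜 d) : LeonardSystem K 𝒜 d where
  A := Φ.A
  E := fun i => Φ.E i.rev
  Astar := Φ.Astar
  Estar := Φ.Estar
  multiplicityFree_A := Φ.multiplicityFree_A
  multiplicityFree_Astar := Φ.multiplicityFree_Astar
  ordering_E := Φ.ordering_E.elim fun _ h => ⟨_, h.rev⟩
  ordering_Estar := Φ.ordering_Estar
  E_Astar_E_eq_zero := fun i j h =>
    Φ.E_Astar_E_eq_zero _ _ (by rw [abs_rev_sub_rev]; exact h)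
  E_Astar_E_ne_zero := fun i j h =>
    Φ.E_Astar_E_ne_zero _ _ (by rw [abs_rev_sub_rev]; exact h)
  Estar_A_Estar_eq_zero := Φ.Estar_A_Estar_eq_zero
  Estar_A_Estar_ne_zero := Φ.Estar_A_Estar_ne_zero

/-- `θ_i` is the eigenvalue of `A` associated with `E_i`, for all `i`. -/
def IsEigenvalueSequence (Φ : LeonardSystem K 𝒜 d) (θ : Fin (d + 1) → K) : Prop :=
  IsIdempotentOrdering Φ.A θ Φ.E

/-- `θ*_i` is the eigenvalue of `A*` associated with `E*_i`, for all `i`. -/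
def IsDualEigenvalueSequence (Φ : LeonardSystem K 𝒜 d) (θstar : Fin (d + 1) → K) : Prop :=
  IsIdempotentOrdering Φ.Astar θstar Φ.Estar

/-- `u_0, …, u_d` is a `Φ`-split basis of the `𝒜`-module `V` with scalars
`varphi_1, …, varphi_d`. The scalar `varphi_i` is stored at position `i - 1` of `Fin d`. -/
structure IsSplitBasis (Φ : LeonardSystem K 𝒜 d) {V : Type*} [AddCommGroup V] [Module K V]
    [Module 𝒜 V] (θ θstar : Fin (d + 1) → K) (varphi : Fin d → K)
    (u : Module.Basis (Fin (d + 1)) K V) : Prop where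
  A_smul : ∀ j : Fin d, Φ.A • u j.castSucc = θ j.castSucc • u j.castSucc + u j.succ
  A_smul_last : Φ.A • u (Fin.last d) = θ (Fin.last d) • u (Fin.last d)
  Astar_smul : ∀ j : Fin d,
    Φ.Astar • u j.succ = varphi j • u j.castSucc + θstar j.succ • u j.succ
  Astar_smul_zero : Φ.Astar • u 0 = θstar 0 • u 0

/-- `varphi_1, …, varphi_d` is the first split sequence of `Φ` (read off on the simple
`𝒜`-module `V`). -/
def IsFirstSplitSequence (Φ : LeonardSystem K 𝒜 d) (V : Type*) [AddCommGroup V] [Module K V]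
    [Module 𝒜 V] (varphi : Fin d → K) : Prop :=
  ∃ θ θstar : Fin (d + 1) → K, Φ.IsEigenvalueSequence θ ∧ Φ.IsDualEigenvalueSequence θstar ∧
    ∃ u : Module.Basis (Fin (d + 1)) K V, Φ.IsSplitBasis θ θstar varphi u

end LeonardSystem

/-- A sequence `({θ_i}_{i=0}^d; {θ*_i}_{i=0}^d; {varphi_i}_{i=1}^d; {phi_i}_{i=1}^d)`.
The scalars `varphi_i` and `phi_i` are stored at position `i - 1` of `Fin d`. -/
structure LeonardArray (K : Type*) (d : ℕ) where
  θ : Fin (d + 1) → K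
  θstar : Fin (d + 1) → K
  varphi : Fin d → K
  phi : Fin d → K

namespace LeonardSystem

/-- `p` is the parameter array of `Φ`: eigenvalue sequence, dual eigenvalue sequence, first split
sequence of `Φ`, and first split sequence of `Φ^⇓` (the second split sequence of `Φ`). -/
structure IsParameterArray (Φ : LeonardSystem K 𝒜 d) (V : Type*) [AddCommGroup V] [Module K V]
    [Module 𝒜 V] (p : LeonardArray K d) : Prop where
  eigenvalue : Φ.IsEigenvalueSequence p.θ
  dualEigenvalue : Φ.IsDualEigenvalueSequence p.θstar
  firstSplit : Φ.IsFirstSplitSequence V p.varphi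
  secondSplit : Φ.Down.IsFirstSplitSequence V p.phi

end LeonardSystem

/-- `(λ - θ_0)(λ - θ_1) ⋯ (λ - θ_{i-1})`, for `0 ≤ i ≤ d`. -/
noncomputable def tauPoly (θ : Fin (d + 1) → K) (i : ℕ) : K[X] :=
  ∏ h ∈ Finset.univ.filter (fun h : Fin (d + 1) => (h : ℕ) < i), (X - C (θ h))

/-- `(λ - θ_d)(λ - θ_{d-1}) ⋯ (λ - θ_{d-i+1})`, for `0 ≤ i ≤ d`. -/
noncomputable def etaPoly (θ : Fin (d + 1) → K) (i : ℕ) : K[X] :=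
  ∏ h ∈ Finset.univ.filter (fun h : Fin (d + 1) => d - (h : ℕ) < i), (X - C (θ h))

/-- The trace of an element of `𝒜`, computed on the simple `𝒜`-module `V`. -/
noncomputable def elementTrace (K : Type*) [Field K] {𝒜 : Type*} [Ring 𝒜] [Algebra K 𝒜]
    (V : Type*) [AddCommGroup V] [Module K V] [Module 𝒜 V] [IsScalarTower K 𝒜 V] (Y : 𝒜) : K :=
  LinearMap.trace K V (Algebra.lsmul K K V Y)

end Leonard

/-!
The simple module `V` of `𝒜 ≅ Mat_{d+1}(K)` has dimension `d + 1`, and `𝒜` acts on it as the full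
endomorphism algebra. Hence `A` and `A*` have eigenbases `w` and `ws`, the idempotents `E_i` and
`E*_i` are the rank-one projections onto the basis vectors, `tr(Y E_i)` is the diagonal coefficient
`w^i(Y w_i)`, and the Leonard conditions say that each of `A`, `A*` is irreducible tridiagonal in the
eigenbasis of the other (`LeonardSystem.exists_isLeonardPair`).

Existence of a split basis (`IsLeonardPair.exists_isSplit`): take `u_i = τ_i(A) ws_0`. It is
triangular with respect to the flag spanned by `ws_0, ws_1, …`, by tridiagonality of `A`, and with
respect to the opposite flag of `w`, as `τ_i` vanishes at `θ_0, …, θ_{i-1}`. Since `A* - θ*_i` lowers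
each of these flags by one step, it sends `u_i` to a multiple of `u_{i-1}`.

The formulas (`ne_zero_and_eq_ratio`): suppose that `a` sends `u_j` to `θ_j u_j + γ_j u_{j+1}`, that
`b` sends `u_{j+1}` to `φ_j u_j + θ*_{j+1} u_{j+1}`, and that `f` is a left eigenvector of `b` for
`θ*_0`. Then `τ_j(a) u_0` is `γ_0 ⋯ γ_{j-1} u_j`, and evaluating `f (b u_{j+1})` in two ways gives
`(θ*_0 - θ*_{j+1}) f(u_{j+1}) = φ_j f(u_j)`; so `γ_j φ_j` is `θ*_0 - θ*_{j+1}` times a ratio of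
consecutive values `f(τ_j(a) u_0)`. The four expressions for the first split sequence are this
statement for the basis `u`, for `u` reversed with `A` and `A*` exchanged, for the dual basis with
`A` and `A*` exchanged, and for the reversed dual basis. The denominators are nonzero because
`E_{j-1} A* E_j ≠ 0` forces the split sequence to have no zero (`IsSplit.scalar_ne_zero`). The
expressions for the second split sequence are the same four for `Φ^⇓`, and uniqueness follows from
any one of them.
-/

/-! ### The action of the algebra on its simple module -/

section Action

variable {K : Type*} [Field K] {𝒜 : Type*} [Ring 𝒜] [Algebra K 𝒜] {d : ℕ}
  (V : Type*) [AddCommGroup V] [Module K V] [Module 𝒜 V] [IsScalarTower K 𝒜 V]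

theorem lsmul_injective_of_matrix [Nontrivial V]
    (h𝒜 : Nonempty (𝒜 ≃ₐ[K] Matrix (Fin (d + 1)) (Fin (d + 1)) K)) :
    Function.Injective (Algebra.lsmul K K V : 𝒜 →ₐ[K] Module.End K V) := by
  obtain ⟨e⟩ := h𝒜
  have : IsSimpleRing 𝒜 := IsSimpleRing.of_ringEquiv e.symm.toRingEquiv inferInstance
  exact (Algebra.lsmul K K V : 𝒜 →ₐ[K] Module.End K V).toRingHom.injective

/-- If `v` is not killed by the matrix unit `e_{00}`, then the `d + 1` vectors `e_{i0} v` span the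
simple module. -/
theorem exists_span_eq_top_of_matrix [IsSimpleModule 𝒜 V]
    (h𝒜 : Nonempty (𝒜 ≃ₐ[K] Matrix (Fin (d + 1)) (Fin (d + 1)) K)) :
    ∃ s : Fin (d + 1) → V, Submodule.span K (Set.range s) = ⊤ := by
  have : Nontrivial V := IsSimpleModule.nontrivial 𝒜 V
  have hinj := lsmul_injective_of_matrix V h𝒜
  obtain ⟨e⟩ := h𝒜
  have h0 : Algebra.lsmul K K V (e.symm (Matrix.single 0 0 1)) ≠ 0 := by
    rw [Ne, map_eq_zero_iff _ hinj, map_eq_zero_iff _ e.symm.injective]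
    intro h
    simpa using congr_fun₂ h 0 0
  obtain ⟨v, hv⟩ : ∃ v : V, e.symm (Matrix.single 0 0 1) • v ≠ 0 := by
    by_contra! h
    exact h0 (LinearMap.ext h)
  refine ⟨fun i => e.symm (Matrix.single i 0 1) • v, eq_top_iff.2 fun x _ => ?_⟩
  obtain ⟨y, rfl⟩ := IsSimpleModule.toSpanSingleton_surjective 𝒜 hv x
  have hy : y * e.symm (Matrix.single 0 0 1) =
      ∑ i, e y i 0 • e.symm (Matrix.single i 0 1) := by
    apply e.injective
    simp only [map_mul, map_sum, map_smul, AlgEquiv.apply_symm_apply]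
    ext i j
    rw [Matrix.sum_apply]
    by_cases hj : j = 0
    · subst hj; simp [Matrix.single_apply]
    · simp [hj, Ne.symm hj]
  rw [LinearMap.toSpanSingleton_apply, smul_smul, hy, Finset.sum_smul]
  refine Submodule.sum_mem _ fun i _ => ?_
  rw [smul_assoc]
  exact Submodule.smul_mem _ _ (Submodule.subset_span ⟨i, rfl⟩)

theorem finrank_and_lsmul_bijective_of_matrix [IsSimpleModule 𝒜 V]
    (h𝒜 : Nonempty (𝒜 ≃ₐ[K] Matrix (Fin (d + 1)) (Fin (d + 1)) K)) :
    Module.Finite K V ∧ Module.finrank K V = d + 1 ∧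
      Function.Bijective (Algebra.lsmul K K V : 𝒜 →ₐ[K] Module.End K V) := by
  have : Nontrivial V := IsSimpleModule.nontrivial 𝒜 V
  have hinj := lsmul_injective_of_matrix V h𝒜
  obtain ⟨s, hs⟩ := exists_span_eq_top_of_matrix V h𝒜
  obtain ⟨e⟩ := h𝒜
  have hfin : Module.Finite K V :=
    Module.finite_def.2 (hs ▸ Submodule.fg_span (Set.finite_range s))
  have hfin' : Module.Finite K 𝒜 := Module.Finite.equiv e.symm.toLinearEquiv
  have hle : Module.finrank K V ≤ d + 1 := by
    have h := finrank_range_le_card (R := K) s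
    rwa [Set.finrank, hs, finrank_top, Fintype.card_fin] at h
  have hA : Module.finrank K 𝒜 = (d + 1) * (d + 1) := by
    rw [e.toLinearEquiv.finrank_eq, Module.finrank_matrix]; simp
  have hle' := LinearMap.finrank_le_finrank_of_injective
    (f := (Algebra.lsmul K K V : 𝒜 →ₐ[K] Module.End K V).toLinearMap) hinj
  have hE : Module.finrank K (Module.End K V) = Module.finrank K V * Module.finrank K V :=
    Module.finrank_linearMap K K V V
  have hn : Module.finrank K V = d + 1 := by
    rw [hA, hE] at hle'
    exact le_antisymm hle (Nat.mul_self_le_mul_self_iff.1 hle')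
  refine ⟨hfin, hn, hinj, ?_⟩
  exact (LinearMap.injective_iff_surjective_of_finrank_eq_finrank
    (f := (Algebra.lsmul K K V : 𝒜 →ₐ[K] Module.End K V).toLinearMap)
    (by rw [hA, hE, hn])).1 hinj

variable {V}

theorem aeval_smul_of_smul_eq {X : 𝒜} {c : K} {x : V} (h : X • x = c • x) (p : K[X]) :
    aeval X p • x = p.eval c • x := by
  have := Module.End.aeval_apply_of_hasEigenvector (f := Algebra.lsmul K K V X) (p := p) (μ := c)
    (x := x)
  by_cases hx : x = 0
  · simp [hx]
  · rw [← this ⟨Module.End.mem_eigenspace_iff.2 h, hx⟩, aeval_algHom_apply]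
    rfl

/-- A multiplicity-free element has a basis of eigenvectors `w_i`, and its primitive idempotent
`E_i` is the projection of `V` onto the line of `w_i`. -/
theorem IsIdempotentOrdering.exists_basis [IsSimpleModule 𝒜 V]
    (h𝒜 : Nonempty (𝒜 ≃ₐ[K] Matrix (Fin (d + 1)) (Fin (d + 1)) K))
    {X : 𝒜} {θ : Fin (d + 1) → K} {E : Fin (d + 1) → 𝒜} (h : IsIdempotentOrdering X θ E) :
    ∃ w : Module.Basis (Fin (d + 1)) K V, (∀ i, X • w i = θ i • w i) ∧
      ∀ i x, E i • x = w.coord i x • w i := by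
  obtain ⟨hfin, hn, hbij⟩ := finrank_and_lsmul_bijective_of_matrix V h𝒜
  have hev : ∀ i, ∃ x, Module.End.HasEigenvector (Algebra.lsmul K K V X) (θ i) x := by
    intro i
    apply Module.End.HasEigenvalue.exists_hasEigenvector
    rw [Module.End.hasEigenvalue_iff_mem_spectrum]
    have hspec : θ i ∈ spectrum K X := h.1.2 ▸ ⟨i, rfl⟩
    rwa [← AlgEquiv.spectrum_eq (AlgEquiv.ofBijective _ hbij) X] at hspec
  choose x hx using hev
  have hli := Module.End.eigenvectors_linearIndependent' (Algebra.lsmul K K V X) θ h.1.1 x hx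
  set w := basisOfLinearIndependentOfCardEqFinrank hli (by simp [hn])
  have hw : ∀ i, X • w i = θ i • w i := by
    intro i
    rw [coe_basisOfLinearIndependentOfCardEqFinrank]
    exact (hx i).apply_eq_smul
  refine ⟨w, hw, fun i y => ?_⟩
  suffices H : Algebra.lsmul K K V (E i) = (w.coord i).smulRight (w i) from LinearMap.congr_fun H y
  refine w.ext fun j => ?_
  rw [LinearMap.smulRight_apply, Module.Basis.coord_apply, w.repr_self,
    Finsupp.single_apply, h.2 i, primitiveIdempotent]
  change aeval X _ • w j = _
  rw [aeval_smul_of_smul_eq (hw j), eval_prod]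
  simp only [eval_mul, eval_C, eval_sub, eval_X]
  split_ifs with hij
  · subst hij
    congr 1
    refine Finset.prod_eq_one fun k hk => inv_mul_cancel₀ (sub_ne_zero.2 fun hjk => ?_)
    exact (Finset.mem_erase.1 hk).1 (h.1.1 hjk).symm
  · rw [Finset.prod_eq_zero (Finset.mem_erase.2 ⟨hij, Finset.mem_univ j⟩) (by simp),
      zero_smul, zero_smul]

/-- The trace against a rank-one idempotent is a diagonal matrix coefficient. -/
theorem elementTrace_mul_eq_coord {w : Module.Basis (Fin (d + 1)) K V} {E : 𝒜}
    {i : Fin (d + 1)} (hE : ∀ x : V, E • x = w.coord i x • w i) (Y : 𝒜) :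
    elementTrace K V (Y * E) = w.coord i (Y • w i) := by
  have : Module.Finite K V := Module.Finite.of_basis w
  have h : Algebra.lsmul K K V (Y * E) =
      (w.coord i).smulRight (Algebra.lsmul K K V Y (w i)) := by
    ext x
    rw [map_mul, Module.End.mul_apply, LinearMap.smulRight_apply]
    change Algebra.lsmul K K V Y (E • x) = _
    rw [hE, map_smul]
  rw [elementTrace, h, LinearMap.trace_smulRight]
  rfl

end Action

/-! ### The products `τ_i` and `η_i` -/

section Poly

variable {K : Type*} [Field K] {d : ℕ}

theorem tauPoly_zero (θ : Fin (d + 1) → K) : tauPoly θ 0 = 1 := by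
  simp [tauPoly]

theorem tauPoly_succ (θ : Fin (d + 1) → K) (j : Fin (d + 1)) :
    tauPoly θ (j + 1) = (X - C (θ j)) * tauPoly θ j := by
  have h : Finset.univ.filter (fun h : Fin (d + 1) => (h : ℕ) < j + 1) =
      insert j (Finset.univ.filter (fun h : Fin (d + 1) => (h : ℕ) < j)) := by
    ext k
    simp only [Finset.mem_filter, Finset.mem_univ, true_and, Finset.mem_insert, Fin.ext_iff]
    omega
  rw [tauPoly, h, Finset.prod_insert (by simp), tauPoly]

theorem tauPoly_rev (θ : Fin (d + 1) → K) (i : ℕ) :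
    tauPoly (fun j => θ j.rev) i = etaPoly θ i := by
  refine Finset.prod_bij' (fun j _ => j.rev) (fun j _ => j.rev) ?_ ?_ ?_ ?_ ?_ <;>
    (simp [Fin.val_rev]; try omega)

theorem etaPoly_rev (θ : Fin (d + 1) → K) (i : ℕ) :
    etaPoly (fun j => θ j.rev) i = tauPoly θ i := by
  rw [← tauPoly_rev]; simp only [Fin.rev_rev]

theorem eval_tauPoly_eq_zero {θ : Fin (d + 1) → K} {i : ℕ} {m : Fin (d + 1)} (h : (m : ℕ) < i) :
    (tauPoly θ i).eval (θ m) = 0 := by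
  rw [tauPoly, eval_prod]
  exact Finset.prod_eq_zero (i := m) (by simpa using h) (by simp)

theorem eval_tauPoly_ne_zero {θ : Fin (d + 1) → K} (hθ : Function.Injective θ) (m : Fin (d + 1)) :
    (tauPoly θ m).eval (θ m) ≠ 0 := by
  rw [tauPoly, eval_prod, Finset.prod_ne_zero_iff]
  intro k hk
  rw [eval_sub, eval_X, eval_C, sub_ne_zero]
  rintro h
  have := hθ h
  subst this
  simp at hk

end Poly

/-! ### Scalars of a split sequence as ratios of matrix coefficients -/

section Ratio

variable {K : Type*} [Field K] {d : ℕ} {W : Type*} [AddCommGroup W] [Module K W]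

theorem aeval_dualMap (a : Module.End K W) (p : K[X]) (f : Module.Dual K W) (x : W) :
    aeval (a.dualMap : Module.End K (Module.Dual K W)) p f x = f (aeval a p x) := by
  induction p using Polynomial.induction_on' generalizing f with
  | add p q hp hq => simp [hp, hq]
  | monomial n c =>
    simp only [aeval_monomial, Module.End.mul_apply, Module.algebraMap_end_apply,
      LinearMap.smul_apply, map_smul]
    congr 1
    induction n generalizing f with
    | zero => simp
    | succ n ih => rw [pow_succ, Module.End.mul_apply, ih, pow_succ', Module.End.mul_apply]; rfl

theorem aeval_tauPoly_succ (a : Module.End K W) (θ : Fin (d + 1) → K) (j : Fin (d + 1)) (x : W) :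
    aeval a (tauPoly θ (j + 1)) x =
      a (aeval a (tauPoly θ j) x) - θ j • aeval a (tauPoly θ j) x := by
  rw [tauPoly_succ, map_mul, Module.End.mul_apply]
  simp [LinearMap.sub_apply, Module.algebraMap_end_apply]

/-- Let `a` raise and `b` lower the sequence `u`, with coefficients `γ` and `φ`, and let `f` be a
left eigenvector of `b` for the eigenvalue at `u_0`. Applying `f ∘ b` to `u_{j+1}` relates
`f u_{j+1}` to `f u_j`, while `τ_j(a) u_0` is `γ_0 ⋯ γ_{j-1} u_j`. -/
theorem ne_zero_and_eq_ratio {a b : Module.End K W} {u : Fin (d + 1) → W}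
    {θ θs : Fin (d + 1) → K} {γ φ : Fin d → K}
    (ha : ∀ j : Fin d, a (u j.castSucc) = θ j.castSucc • u j.castSucc + γ j • u j.succ)
    (hb : ∀ j : Fin d, b (u j.succ) = φ j • u j.castSucc + θs j.succ • u j.succ)
    {f : Module.Dual K W} (hf : ∀ x, f (b x) = θs 0 * f x) {x : W}
    (hx : u 0 = f (u 0) • x) (hu : f (u 0) ≠ 0) (hγφ : ∀ j, γ j * φ j ≠ 0) (j : Fin d) :
    f (aeval a (tauPoly θ j) x) ≠ 0 ∧ γ j * φ j = (θs 0 - θs j.succ) *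
      (f (aeval a (tauPoly θ (j + 1)) x) / f (aeval a (tauPoly θ j) x)) := by
  have hsucc : ∀ j : Fin d, aeval a (tauPoly θ (j + 1)) x =
      a (aeval a (tauPoly θ j) x) - θ j.castSucc • aeval a (tauPoly θ j) x :=
    fun j => aeval_tauPoly_succ a θ j.castSucc x
  have hmul : ∀ i : Fin (d + 1), ∃ c : K, aeval a (tauPoly θ i) x = c • u i := by
    intro i
    induction i using Fin.induction with
    | zero =>
      refine ⟨(f (u 0))⁻¹, ?_⟩
      rw [Fin.val_zero, tauPoly_zero, map_one, Module.End.one_apply, eq_inv_smul_iff₀ hu]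
      exact hx.symm
    | succ j ih =>
      obtain ⟨c, hc⟩ := ih
      rw [Fin.val_castSucc] at hc
      refine ⟨c * γ j, ?_⟩
      rw [Fin.val_succ, hsucc, hc, map_smul, ha]
      module
  have hstep : ∀ j : Fin d, (θs 0 - θs j.succ) * f (aeval a (tauPoly θ (j + 1)) x) =
      γ j * φ j * f (aeval a (tauPoly θ j) x) := by
    intro j
    obtain ⟨c, hc⟩ := hmul j.castSucc
    rw [Fin.val_castSucc] at hc
    have h1 := hf (u j.succ)
    rw [hb, map_add, map_smul, map_smul, smul_eq_mul, smul_eq_mul] at h1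
    have h2 : c • a (u j.castSucc) - θ j.castSucc • c • u j.castSucc = (c * γ j) • u j.succ := by
      rw [ha]; module
    rw [hsucc, hc, map_smul, h2, map_smul, map_smul, smul_eq_mul, smul_eq_mul]
    linear_combination (-c * γ j) * h1
  have hne : ∀ i : Fin (d + 1), f (aeval a (tauPoly θ i) x) ≠ 0 := by
    intro i
    induction i using Fin.induction with
    | zero =>
      intro h
      rw [Fin.val_zero, tauPoly_zero, map_one, Module.End.one_apply] at h
      rw [hx, map_smul, h, smul_zero] at hu
      exact hu rfl
    | succ j ih =>
      rw [Fin.val_castSucc] at ih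
      intro h
      have := hstep j
      rw [Fin.val_succ] at h
      rw [h, mul_zero] at this
      exact mul_ne_zero (hγφ j) ih this.symm
  have hj := hne j.castSucc
  rw [Fin.val_castSucc] at hj
  refine ⟨hj, ?_⟩
  rw [← mul_div_assoc, hstep, mul_div_assoc, div_self hj, mul_one]

end Ratio

/-! ### Leonard pairs in terms of two eigenbases -/

section Pair

variable {K : Type*} [Field K] {d : ℕ} {V : Type*} [AddCommGroup V] [Module K V]

section Eigenbasis

variable {ι : Type*} {b : Module.End K V} {θ : ι → K} {w : Module.Basis ι K V}

theorem coord_eigenbasis (h : ∀ i, b (w i) = θ i • w i) (i : ι) (x : V) :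
    w.coord i (b x) = θ i * w.coord i x := by
  suffices H : (w.coord i).comp b = θ i • w.coord i from LinearMap.congr_fun H x
  refine w.ext fun j => ?_
  classical
  simp only [LinearMap.comp_apply, h, map_smul, LinearMap.smul_apply, Module.Basis.coord_apply,
    w.repr_self, Finsupp.single_apply, smul_eq_mul]
  split_ifs with hj <;> simp [hj]

theorem eq_coord_smul_of_eigenvector [Fintype ι] (h : ∀ i, b (w i) = θ i • w i) (hθ : Function.Injective θ)
    {k : ι} {x : V} (hx : b x = θ k • x) : x = w.coord k x • w k := by
  conv_lhs => rw [← w.sum_repr x]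
  refine Finset.sum_eq_single k (fun i _ hi => ?_) (by simp)
  have h1 := coord_eigenbasis h i x
  rw [hx, map_smul, smul_eq_mul] at h1
  have h2 : (θ k - θ i) * w.coord i x = 0 := by rw [sub_mul, h1, sub_self]
  have h3 := (mul_eq_zero.1 h2).resolve_left (sub_ne_zero.2 fun h' => hi (hθ h'.symm))
  rw [← Module.Basis.coord_apply, h3, zero_smul]

theorem eq_smul_coord_of_left_eigenvector (h : ∀ i, b (w i) = θ i • w i)
    (hθ : Function.Injective θ) {k : ι} {f : Module.Dual K V} (hf : ∀ x, f (b x) = θ k * f x) :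
    f = f (w k) • w.coord k := by
  classical
  refine w.ext fun i => ?_
  rw [LinearMap.smul_apply, Module.Basis.coord_apply, w.repr_self, Finsupp.single_apply]
  split_ifs with hi
  · simp [hi]
  · have h1 := hf (w i)
    rw [h, map_smul, smul_eq_mul] at h1
    have h2 : (θ i - θ k) * f (w i) = 0 := by rw [sub_mul, h1, sub_self]
    rw [(mul_eq_zero.1 h2).resolve_left (sub_ne_zero.2 fun h' => hi (hθ h')), smul_zero]

theorem coord_aeval_eigenbasis (h : ∀ i, b (w i) = θ i • w i) (i : ι) (p : K[X]) (x : V) :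
    w.coord i (aeval b p x) = p.eval (θ i) * w.coord i x := by
  have h' : ∀ i, aeval b p (w i) = p.eval (θ i) • w i := fun i =>
    Module.End.aeval_apply_of_hasEigenvector
      ⟨Module.End.mem_eigenspace_iff.2 (h i), w.ne_zero i⟩
  exact coord_eigenbasis h' i x

end Eigenbasis

/-- `a` and `b` are diagonal in the bases `w` and `ws`, with distinct eigenvalues `θ_i` and `θs_i`,
and each of them is irreducible tridiagonal in the eigenbasis of the other. -/
structure IsLeonardPair (a b : Module.End K V) (θ θs : Fin (d + 1) → K)
    (w ws : Module.Basis (Fin (d + 1)) K V) : Prop where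
  inj : Function.Injective θ
  inj_star : Function.Injective θs
  eig : ∀ i, a (w i) = θ i • w i
  eig_star : ∀ i, b (ws i) = θs i • ws i
  coord_eq_zero : ∀ i j : Fin (d + 1), 1 < |(i : ℤ) - (j : ℤ)| → w.coord i (b (w j)) = 0
  coord_ne_zero : ∀ i j : Fin (d + 1), |(i : ℤ) - (j : ℤ)| = 1 → w.coord i (b (w j)) ≠ 0
  coord_star_eq_zero : ∀ i j : Fin (d + 1), 1 < |(i : ℤ) - (j : ℤ)| →
    ws.coord i (a (ws j)) = 0
  coord_star_ne_zero : ∀ i j : Fin (d + 1), |(i : ℤ) - (j : ℤ)| = 1 →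
    ws.coord i (a (ws j)) ≠ 0

/-- In the basis `u` the map `a` is lower bidiagonal with subdiagonal entries `1`, and `b` is upper
bidiagonal with superdiagonal entries `φ`. -/
structure IsSplit (a b : Module.End K V) (θ θs : Fin (d + 1) → K) (φ : Fin d → K)
    (u : Module.Basis (Fin (d + 1)) K V) : Prop where
  raise : ∀ j : Fin d, a (u j.castSucc) = θ j.castSucc • u j.castSucc + u j.succ
  raise_last : a (u (Fin.last d)) = θ (Fin.last d) • u (Fin.last d)
  lower : ∀ j : Fin d, b (u j.succ) = φ j • u j.castSucc + θs j.succ • u j.succ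
  lower_zero : b (u 0) = θs 0 • u 0

variable {a b : Module.End K V} {θ θs : Fin (d + 1) → K} {φ : Fin d → K}
  {u w ws : Module.Basis (Fin (d + 1)) K V}

namespace IsSplit

theorem coord_succ_raise (h : IsSplit a b θ θs φ u) (j : Fin d) (x : V) :
    u.coord j.succ (a x) = θ j.succ * u.coord j.succ x + u.coord j.castSucc x := by
  suffices H : (u.coord j.succ).comp a = θ j.succ • u.coord j.succ + u.coord j.castSucc from
    LinearMap.congr_fun H x
  refine u.ext fun k => ?_
  simp only [LinearMap.comp_apply, LinearMap.add_apply, LinearMap.smul_apply]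
  cases k using Fin.lastCases with
  | last =>
    simp only [h.raise_last, map_smul, Module.Basis.coord_apply, u.repr_self,
      Finsupp.single_apply, (Fin.castSucc_lt_last j).ne', if_false, add_zero]
    split_ifs with hj <;> simp [hj]
  | cast k =>
    simp only [h.raise, map_smul, map_add, Module.Basis.coord_apply, u.repr_self,
      Finsupp.single_apply, Fin.succ_inj, Fin.castSucc_inj]
    split_ifs with hj <;> simp [hj]

theorem coord_zero_raise (h : IsSplit a b θ θs φ u) (x : V) :
    u.coord 0 (a x) = θ 0 * u.coord 0 x := by
  suffices H : (u.coord 0).comp a = θ 0 • u.coord 0 from LinearMap.congr_fun H x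
  refine u.ext fun k => ?_
  simp only [LinearMap.comp_apply, LinearMap.smul_apply]
  cases k using Fin.lastCases with
  | last =>
    simp only [h.raise_last, map_smul, Module.Basis.coord_apply, u.repr_self,
      Finsupp.single_apply]
    split_ifs with hj <;> simp [hj]
  | cast k =>
    simp only [h.raise, map_smul, map_add, Module.Basis.coord_apply, u.repr_self,
      Finsupp.single_apply, Fin.succ_ne_zero, if_false, add_zero]
    split_ifs with hj <;> simp [hj]

theorem coord_castSucc_lower (h : IsSplit a b θ θs φ u) (j : Fin d) (x : V) :
    u.coord j.castSucc (b x) =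
      φ j * u.coord j.succ x + θs j.castSucc * u.coord j.castSucc x := by
  suffices H : (u.coord j.castSucc).comp b =
      φ j • u.coord j.succ + θs j.castSucc • u.coord j.castSucc from LinearMap.congr_fun H x
  refine u.ext fun k => ?_
  simp only [LinearMap.comp_apply, LinearMap.add_apply, LinearMap.smul_apply]
  cases k using Fin.cases with
  | zero =>
    simp only [h.lower_zero, map_smul, Module.Basis.coord_apply, u.repr_self,
      Finsupp.single_apply, (Fin.succ_ne_zero j).symm, if_false, smul_zero, zero_add]
    split_ifs with hj <;> simp [hj]
  | succ k =>
    simp only [h.lower, map_smul, map_add, Module.Basis.coord_apply, u.repr_self,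
      Finsupp.single_apply, Fin.succ_inj, Fin.castSucc_inj]
    congr 1
    · split_ifs with hj <;> simp [hj]
    · split_ifs with hj <;> simp [hj]

theorem coord_last_lower (h : IsSplit a b θ θs φ u) (x : V) :
    u.coord (Fin.last d) (b x) = θs (Fin.last d) * u.coord (Fin.last d) x := by
  suffices H : (u.coord (Fin.last d)).comp b = θs (Fin.last d) • u.coord (Fin.last d) from
    LinearMap.congr_fun H x
  refine u.ext fun k => ?_
  simp only [LinearMap.comp_apply, LinearMap.smul_apply]
  cases k using Fin.cases with
  | zero =>
    simp only [h.lower_zero, map_smul, Module.Basis.coord_apply, u.repr_self,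
      Finsupp.single_apply]
    split_ifs with hj <;> simp [hj]
  | succ k =>
    simp only [h.lower, map_smul, map_add, Module.Basis.coord_apply, u.repr_self,
      Finsupp.single_apply, (Fin.castSucc_lt_last k).ne, if_false, smul_zero, zero_add]
    split_ifs with hj <;> simp [hj]

/-- If `φ_j = 0`, then the span of `u_{j+1}, …, u_d`, which is the sum of the eigenspaces of `a` for
`θ_{j+1}, …, θ_d`, is invariant under `b`; but `b` is irreducible tridiagonal on the eigenspaces
of `a`. -/
theorem scalar_ne_zero (h : IsSplit a b θ θs φ u) (hp : IsLeonardPair a b θ θs w ws)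
    (j : Fin d) : φ j ≠ 0 := by
  intro hφ
  have hu : ∀ k : Fin (d + 1), j.castSucc < k → w.coord j.castSucc (u k) = 0 := by
    intro k
    induction k using Fin.induction with
    | zero => intro hk; exact absurd hk (Fin.not_lt_zero _)
    | succ k ih =>
      intro hk
      have h1 := coord_eigenbasis hp.eig j.castSucc (u k.castSucc)
      rw [h.raise, map_add, map_smul, smul_eq_mul] at h1
      rcases (Fin.castSucc_lt_succ_iff.1 hk).eq_or_lt with rfl | hlt
      · linear_combination h1
      · rw [ih (by simpa using hlt), mul_zero, zero_add, mul_zero] at h1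
        exact h1
  have hw : ∀ k : Fin (d + 1), k < j.succ → u.coord k (w j.succ) = 0 := by
    have hne : ∀ k : Fin (d + 1), k < j.succ → θ j.succ - θ k ≠ 0 := fun k hk =>
      sub_ne_zero.2 fun h' => hk.ne (hp.inj h').symm
    intro k
    induction k using Fin.induction with
    | zero =>
      intro hk
      have h1 := h.coord_zero_raise (w j.succ)
      rw [hp.eig, map_smul, smul_eq_mul] at h1
      refine (mul_eq_zero.1 (?_ : (θ j.succ - θ 0) * _ = 0)).resolve_left (hne _ hk)
      linear_combination h1
    | succ k ih =>
      intro hk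
      have h1 := h.coord_succ_raise k (w j.succ)
      rw [hp.eig, map_smul, smul_eq_mul, ih (k.castSucc_lt_succ.trans hk)] at h1
      refine (mul_eq_zero.1 (?_ : (θ j.succ - θ k.succ) * _ = 0)).resolve_left (hne _ hk)
      linear_combination h1
  refine hp.coord_ne_zero j.castSucc j.succ (by simp) ?_
  rw [← u.sum_repr (w j.succ), map_sum, map_sum]
  refine Finset.sum_eq_zero fun k _ => ?_
  rw [map_smul, map_smul]
  rcases lt_or_ge k j.succ with hk | hk
  · rw [← Module.Basis.coord_apply, hw k hk, zero_smul]
  · obtain ⟨k, rfl⟩ : ∃ m : Fin d, k = m.succ :=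
      ⟨_, (Fin.succ_pred k (Fin.pos_of_ne_zero (fun h0 => by
        rw [h0] at hk; exact absurd hk (by simp))).ne').symm⟩
    rw [h.lower, map_add, map_smul, map_smul, hu k.succ (Fin.castSucc_lt_succ_iff.2
      (Fin.succ_le_succ_iff.1 hk))]
    rcases (Fin.succ_le_succ_iff.1 hk).eq_or_lt with rfl | hlt
    · simp [hφ]
    · rw [hu k.castSucc (by simpa using hlt)]; simp

theorem eq_ratio_tau (h : IsSplit a b θ θs φ u) (hp : IsLeonardPair a b θ θs w ws) (j : Fin d) :
    ws.coord 0 (aeval a (tauPoly θ j) (ws 0)) ≠ 0 ∧ φ j = (θs 0 - θs j.succ) *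
      (ws.coord 0 (aeval a (tauPoly θ (j + 1)) (ws 0)) /
        ws.coord 0 (aeval a (tauPoly θ j) (ws 0))) := by
  have hx := eq_coord_smul_of_eigenvector hp.eig_star hp.inj_star h.lower_zero
  have := ne_zero_and_eq_ratio (u := u) (γ := 1) (by simpa using h.raise) h.lower
    (coord_eigenbasis hp.eig_star 0) hx
    (fun h0 => u.ne_zero 0 (by rw [hx, h0, zero_smul]))
    (fun j => by simpa using h.scalar_ne_zero hp j) j
  simpa using this

theorem eq_ratio_eta (h : IsSplit a b θ θs φ u) (hp : IsLeonardPair a b θ θs w ws) (j : Fin d) :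
    ws.coord (Fin.last d) (aeval a (etaPoly θ j.rev) (ws (Fin.last d))) ≠ 0 ∧
    φ j = (θs (Fin.last d) - θs j.castSucc) *
      (ws.coord (Fin.last d) (aeval a (etaPoly θ (j.rev + 1)) (ws (Fin.last d))) /
        ws.coord (Fin.last d) (aeval a (etaPoly θ j.rev) (ws (Fin.last d)))) := by
  have hx := eq_smul_coord_of_left_eigenvector hp.eig_star hp.inj_star h.coord_last_lower
  -- On the dual space `a` raises and `b` lowers the reversed dual basis of `u`.
  have := ne_zero_and_eq_ratio (W := Module.Dual K V) (a := a.dualMap) (b := b.dualMap)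
    (u := fun i => u.coord i.rev) (θ := fun i => θ i.rev) (θs := fun i => θs i.rev)
    (γ := 1) (φ := fun i => φ i.rev) (f := Module.Dual.eval K V (ws (Fin.last d)))
    (x := ws.coord (Fin.last d))
    (fun j => LinearMap.ext fun x => by
      simpa [Fin.rev_castSucc, Fin.rev_succ] using h.coord_succ_raise j.rev x)
    (fun j => LinearMap.ext fun x => by
      simpa [Fin.rev_castSucc, Fin.rev_succ] using h.coord_castSucc_lower j.rev x)
    (fun f => by simp [hp.eig_star])
    (by simpa using hx)
    (fun h0 => u.ne_zero (Fin.last d) (by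
      have hc : u.coord (Fin.last d) = 0 := by
        rw [hx]
        simp only [Module.Dual.eval_apply, Fin.rev_zero] at h0
        rw [h0, zero_smul]
      have := LinearMap.congr_fun hc (u (Fin.last d))
      simp at this))
    (fun j => by simpa using h.scalar_ne_zero hp j.rev) j.rev
  simp only [Module.Dual.eval_apply, aeval_dualMap, tauPoly_rev, Fin.rev_rev, Fin.rev_zero,
    Fin.rev_succ, Pi.one_apply, one_mul] at this
  exact this

theorem eq_ratio_tau_dual (h : IsSplit a b θ θs φ u) (hp : IsLeonardPair a b θ θs w ws)
    (j : Fin d) :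
    w.coord 0 (aeval b (tauPoly θs j) (w 0)) ≠ 0 ∧ φ j = (θ 0 - θ j.succ) *
      (w.coord 0 (aeval b (tauPoly θs (j + 1)) (w 0)) /
        w.coord 0 (aeval b (tauPoly θs j) (w 0))) := by
  have hx := eq_smul_coord_of_left_eigenvector hp.eig hp.inj h.coord_zero_raise
  -- On the dual space `b` raises and `a` lowers the dual basis of `u`.
  have := ne_zero_and_eq_ratio (W := Module.Dual K V) (a := b.dualMap) (b := a.dualMap)
    (u := fun i => u.coord i) (θ := θs) (θs := θ)
    (γ := φ) (φ := 1) (f := Module.Dual.eval K V (w 0)) (x := w.coord 0)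
    (fun j => LinearMap.ext fun x => by
      simpa [add_comm] using h.coord_castSucc_lower j x)
    (fun j => LinearMap.ext fun x => by
      simpa [add_comm] using h.coord_succ_raise j x)
    (fun f => by simp [hp.eig])
    hx
    (fun h0 => by
      have hc : u.coord 0 = 0 := by
        rw [hx]
        simp only [Module.Dual.eval_apply] at h0
        rw [h0, zero_smul]
      have := LinearMap.congr_fun hc (u 0)
      simp at this)
    (fun j => by simpa using h.scalar_ne_zero hp j) j
  simp only [Module.Dual.eval_apply, aeval_dualMap, Pi.one_apply, mul_one] at this
  exact this

theorem eq_ratio_eta_dual (h : IsSplit a b θ θs φ u) (hp : IsLeonardPair a b θ θs w ws)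
    (j : Fin d) :
    w.coord (Fin.last d) (aeval b (etaPoly θs j.rev) (w (Fin.last d))) ≠ 0 ∧
    φ j = (θ (Fin.last d) - θ j.castSucc) *
      (w.coord (Fin.last d) (aeval b (etaPoly θs (j.rev + 1)) (w (Fin.last d))) /
        w.coord (Fin.last d) (aeval b (etaPoly θs j.rev) (w (Fin.last d)))) := by
  have hx := eq_coord_smul_of_eigenvector hp.eig hp.inj h.raise_last
  -- `b` raises and `a` lowers the reversed basis `u`.
  have := ne_zero_and_eq_ratio (a := b) (b := a)
    (u := fun i => u i.rev) (θ := fun i => θs i.rev) (θs := fun i => θ i.rev)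
    (γ := fun i => φ i.rev) (φ := 1) (f := w.coord (Fin.last d)) (x := w (Fin.last d))
    (fun j => by simpa [Fin.rev_castSucc, Fin.rev_succ, add_comm] using h.lower j.rev)
    (fun j => by simpa [Fin.rev_castSucc, Fin.rev_succ, add_comm] using h.raise j.rev)
    (by simpa using coord_eigenbasis hp.eig (Fin.last d))
    (by simpa using hx)
    (fun h0 => u.ne_zero (Fin.last d) (by
      rw [Fin.rev_zero] at h0
      rw [hx, h0, zero_smul]))
    (fun j => by simpa using h.scalar_ne_zero hp j.rev) j.rev
  simp only [tauPoly_rev, Fin.rev_rev, Fin.rev_zero,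
    Fin.rev_succ, Pi.one_apply, mul_one] at this
  exact this

end IsSplit

end Pair

/-! ### Existence of a split basis -/

section Existence

variable {K : Type*} [Field K] {d : ℕ} {V : Type*} [AddCommGroup V] [Module K V]

/-- Triangular elimination on a set `P` of indices closed under `r`: the functionals `f_k`, `k ∈ P`,
detect the coefficients `c_k`, `k ∈ P`. -/
theorem coeff_eq_zero_of_triangular {ι : Type*} [Fintype ι] {r : ι → ι → Prop}
    (hr : WellFounded r) {f : ι → Module.Dual K V} {u : ι → V} (hdiag : ∀ i, f i (u i) ≠ 0)
    (hoff : ∀ i j, j ≠ i → ¬ r j i → f i (u j) = 0) {P : ι → Prop}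
    (hP : ∀ i j, P i → r j i → P j) {c : ι → K}
    (hc : ∀ i, P i → f i (∑ j, c j • u j) = 0) (i : ι) (hi : P i) : c i = 0 := by
  induction i using hr.induction with
  | _ i ih =>
    have h1 := hc i hi
    rw [map_sum, Finset.sum_eq_single i (fun j _ hj => ?_) (by simp), map_smul, smul_eq_mul] at h1
    · exact (mul_eq_zero.1 h1).resolve_right (hdiag i)
    · by_cases hji : r j i
      · rw [ih j hji (hP i j hi hji), zero_smul, map_zero]
      · rw [map_smul, hoff i j hj hji, smul_zero]

variable {a b : Module.End K V} {θ θs : Fin (d + 1) → K}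
  {w ws : Module.Basis (Fin (d + 1)) K V}

namespace IsLeonardPair

/-- `τ_i(a) ws_0` lies in the span of `ws_0, …, ws_i`, with nonzero coefficient at `ws_i`. -/
theorem coord_star_tau (hp : IsLeonardPair a b θ θs w ws) (i : Fin (d + 1)) :
    ws.coord i (aeval a (tauPoly θ i) (ws 0)) ≠ 0 ∧
      ∀ j, i < j → ws.coord j (aeval a (tauPoly θ i) (ws 0)) = 0 := by
  induction i using Fin.induction with
  | zero =>
    rw [Fin.val_zero, tauPoly_zero, map_one, Module.End.one_apply]
    exact ⟨by simp, fun j hj => by simp [hj.ne]⟩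
  | succ i ih =>
    obtain ⟨h1, h2⟩ := ih
    have hs := aeval_tauPoly_succ a θ i.castSucc (ws 0)
    rw [Fin.val_castSucc] at h1 h2 hs
    rw [Fin.val_succ, hs]
    set y := aeval a (tauPoly θ i) (ws 0)
    have hay : ∀ j, ws.coord j (a y) = ∑ k, ws.coord k y * ws.coord j (a (ws k)) := by
      intro j
      conv_lhs => rw [← ws.sum_repr y, map_sum, map_sum]
      simp
    constructor
    · rw [map_sub, map_smul, h2 _ i.castSucc_lt_succ, smul_zero, sub_zero, hay,
        Finset.sum_eq_single i.castSucc (fun k _ hk => ?_) (by simp)]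
      · exact mul_ne_zero h1 (hp.coord_star_ne_zero _ _ (by simp))
      · rcases hk.lt_or_gt with hlt | hgt
        · rw [hp.coord_star_eq_zero _ _, mul_zero]
          rw [Fin.lt_def, Fin.val_castSucc] at hlt
          rw [Fin.val_succ, lt_abs]
          left; push_cast; omega
        · rw [h2 k hgt, zero_mul]
    · intro j hj
      rw [map_sub, map_smul, h2 _ (i.castSucc_lt_succ.trans hj), smul_zero, sub_zero, hay]
      refine Finset.sum_eq_zero fun k _ => ?_
      rcases le_or_gt k i.castSucc with hle | hgt
      · rw [hp.coord_star_eq_zero _ _, mul_zero]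
        rw [Fin.le_def, Fin.val_castSucc] at hle
        rw [Fin.lt_def, Fin.val_succ] at hj
        rw [lt_abs]
        left; omega
      · rw [h2 k hgt, zero_mul]

theorem linearIndependent_tau (hp : IsLeonardPair a b θ θs w ws) :
    LinearIndependent K fun i : Fin (d + 1) => aeval a (tauPoly θ i) (ws 0) := by
  rw [Fintype.linearIndependent_iff]
  intro c hc i
  exact coeff_eq_zero_of_triangular (r := (· > ·)) (f := fun i => ws.coord i)
    (P := fun _ => True) wellFounded_gt (fun i => (hp.coord_star_tau i).1)
    (fun i j hj hji => (hp.coord_star_tau j).2 i (lt_of_le_of_ne (not_lt.1 hji) hj))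
    (fun _ _ _ _ => trivial) (fun i _ => by rw [hc, map_zero]) i trivial

/-- With `u_i = τ_i(a) ws_0`, the vector `(b - θs_{i+1}) u_{i+1}` lies in the span of
`ws_0, …, ws_i` and in the span of `w_i, …, w_d`. Both flags are triangular with respect to `u`,
so it is a multiple of `u_i`. -/
theorem exists_isSplit (hp : IsLeonardPair a b θ θs w ws) :
    ∃ (φ : Fin d → K) (u : Module.Basis (Fin (d + 1)) K V), IsSplit a b θ θs φ u := by
  have : Module.Finite K V := Module.Finite.of_basis w
  have hn : Fintype.card (Fin (d + 1)) = Module.finrank K V :=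
    (Module.finrank_eq_card_basis w).symm
  set u := basisOfLinearIndependentOfCardEqFinrank hp.linearIndependent_tau hn with hu_def
  have hu : ∀ i, u i = aeval a (tauPoly θ i) (ws 0) := fun i => by
    rw [hu_def, coe_basisOfLinearIndependentOfCardEqFinrank]
  have hwu : ∀ m i, w.coord m (u i) = (tauPoly θ i).eval (θ m) * w.coord m (ws 0) := fun m i => by
    rw [hu, coord_aeval_eigenbasis hp.eig]
  -- The vector `ws 0` is cyclic for `a`, so it has a component in every eigenspace of `a`.
  have hw0 : ∀ m, w.coord m (ws 0) ≠ 0 := by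
    intro m h0
    have : w.coord m = 0 := u.ext fun i => by rw [hwu, h0, mul_zero, LinearMap.zero_apply]
    have := LinearMap.congr_fun this (w m)
    simp at this
  have hwu_diag : ∀ m, w.coord m (u m) ≠ 0 := fun m => by
    rw [hwu]; exact mul_ne_zero (eval_tauPoly_ne_zero hp.inj m) (hw0 m)
  have hwu_off : ∀ m i, m < i → w.coord m (u i) = 0 := fun m i hmi => by
    rw [hwu, eval_tauPoly_eq_zero hmi, zero_mul]
  have hlow : ∀ j : Fin d, ∃ c : K,
      b (u j.succ) - θs j.succ • u j.succ = c • u j.castSucc := by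
    intro j
    set y := b (u j.succ) - θs j.succ • u j.succ with hy
    have hsum : ∑ k, u.repr y k • u k = y := u.sum_repr y
    have hgt : ∀ k, j.castSucc < k → u.repr y k = 0 := by
      refine coeff_eq_zero_of_triangular (r := (· > ·)) (f := fun i => ws.coord i) (u := u)
        (P := fun k => j.castSucc < k) wellFounded_gt
        (fun i => by rw [hu]; exact (hp.coord_star_tau i).1)
        (fun i k hk hki => by
          rw [hu]; exact (hp.coord_star_tau k).2 i (lt_of_le_of_ne (not_lt.1 hki) hk))
        (fun _ _ h h' => h.trans h') (fun k hk => ?_)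
      rw [hsum, hy, map_sub, map_smul, coord_eigenbasis hp.eig_star, smul_eq_mul, ← sub_mul]
      rcases (Fin.castSucc_lt_iff_succ_le.1 hk).eq_or_lt with rfl | hlt
      · rw [sub_self, zero_mul]
      · rw [hu, (hp.coord_star_tau j.succ).2 k hlt, mul_zero]
    have hlt : ∀ k, k < j.castSucc → u.repr y k = 0 := by
      refine coeff_eq_zero_of_triangular (r := (· < ·)) (f := fun i => w.coord i) (u := u)
        (P := fun k => k < j.castSucc) wellFounded_lt hwu_diag
        (fun i k hk hki => hwu_off i k (lt_of_le_of_ne (not_lt.1 hki) hk.symm))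
        (fun _ _ h h' => lt_trans h' h) (fun k hk => ?_)
      rw [hsum, hy, map_sub, map_smul, hwu_off k _ (hk.trans j.castSucc_lt_succ), smul_zero,
        sub_zero, ← w.sum_repr (u j.succ), map_sum, map_sum]
      refine Finset.sum_eq_zero fun m _ => ?_
      rw [map_smul, map_smul]
      rcases lt_or_ge m j.succ with hm | hm
      · rw [← Module.Basis.coord_apply, hwu_off m _ hm, zero_smul]
      · rw [hp.coord_eq_zero, smul_zero]
        rw [Fin.lt_def, Fin.val_castSucc] at hk
        rw [Fin.le_def, Fin.val_succ] at hm
        rw [lt_abs]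
        right; omega
    refine ⟨u.repr y j.castSucc, ?_⟩
    conv_lhs => rw [← hsum]
    refine Finset.sum_eq_single j.castSucc (fun k _ hk => ?_) (by simp)
    rcases hk.lt_or_gt with h' | h'
    · rw [hlt k h', zero_smul]
    · rw [hgt k h', zero_smul]
  choose φ hφ using hlow
  have hsucc : ∀ i : Fin (d + 1), aeval a (tauPoly θ (i + 1)) (ws 0) = a (u i) - θ i • u i :=
    fun i => by rw [aeval_tauPoly_succ, hu]
  refine ⟨φ, u, fun j => ?_, ?_, fun j => ?_, ?_⟩
  · have := hsucc j.castSucc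
    rw [Fin.val_castSucc, ← Fin.val_succ, ← hu] at this
    rw [this]; abel
  · rw [← sub_eq_zero, ← hsucc]
    refine w.ext_elem fun m => ?_
    rw [← Module.Basis.coord_apply, coord_aeval_eigenbasis hp.eig, eval_tauPoly_eq_zero (i := (Fin.last d : ℕ) + 1) m.is_lt]
    simp
  · rw [← hφ]; abel
  · rw [hu, Fin.val_zero, tauPoly_zero, map_one, Module.End.one_apply, hp.eig_star]

end IsLeonardPair

end Existence

/-! ### Parameter arrays of Leonard systems -/

section System

variable {K : Type*} [Field K] {𝒜 : Type*} [Ring 𝒜] [Algebra K 𝒜] {d : ℕ}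
  {V : Type*} [AddCommGroup V] [Module K V] [Module 𝒜 V] [IsScalarTower K 𝒜 V]

/-- The eigenvalues are determined by the primitive idempotents: both eigenvalue orderings scale the
eigenvector `w_i` fixed by `E_i`. -/
theorem IsIdempotentOrdering.eigenvalue_unique [IsSimpleModule 𝒜 V]
    (h𝒜 : Nonempty (𝒜 ≃ₐ[K] Matrix (Fin (d + 1)) (Fin (d + 1)) K))
    {X : 𝒜} {θ θ' : Fin (d + 1) → K} {E : Fin (d + 1) → 𝒜} (h : IsIdempotentOrdering X θ E)
    (h' : IsIdempotentOrdering X θ' E) : θ = θ' := by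
  obtain ⟨w, hw, hE⟩ := h.exists_basis (V := V) h𝒜
  obtain ⟨w', hw', hE'⟩ := h'.exists_basis (V := V) h𝒜
  funext i
  have h1 : w i = w'.coord i (w i) • w' i := by
    rw [← hE', hE]; simp
  have h2 : X • w i = θ' i • w i := by
    rw [h1, smul_comm, hw', smul_comm]
  rw [hw] at h2
  exact smul_left_injective K (w.ne_zero i) h2

namespace LeonardSystem

/-- `w` and `ws` are eigenbases of `A` and `A*` on which the primitive idempotents are the coordinate
projections. -/
theorem exists_isLeonardPair [IsSimpleModule 𝒜 V]
    (h𝒜 : Nonempty (𝒜 ≃ₐ[K] Matrix (Fin (d + 1)) (Fin (d + 1)) K)) (Φ : LeonardSystem K 𝒜 d)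
    {θ θs : Fin (d + 1) → K} (hθ : Φ.IsEigenvalueSequence θ)
    (hθs : Φ.IsDualEigenvalueSequence θs) :
    ∃ w ws : Module.Basis (Fin (d + 1)) K V,
      IsLeonardPair (Algebra.lsmul K K V Φ.A) (Algebra.lsmul K K V Φ.Astar) θ θs w ws ∧
      (∀ i x, Φ.E i • x = w.coord i x • w i) ∧
      ∀ i x, Φ.Estar i • x = ws.coord i x • ws i := by
  obtain ⟨w, hw, hE⟩ := IsIdempotentOrdering.exists_basis (V := V) h𝒜 hθ
  obtain ⟨ws, hws, hEs⟩ := IsIdempotentOrdering.exists_basis (V := V) h𝒜 hθs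
  have hinj := (finrank_and_lsmul_bijective_of_matrix V h𝒜).2.2.1
  -- `E_i Y E_j` acts as a rank-one map with coefficient `w^i (Y w_j)`.
  have key : ∀ (v : Module.Basis (Fin (d + 1)) K V) (F : Fin (d + 1) → 𝒜),
      (∀ i x, F i • x = v.coord i x • v i) → ∀ (Y : 𝒜) (i j : Fin (d + 1)),
      F i * Y * F j = 0 ↔ v.coord i (Y • v j) = 0 := by
    intro v F hF Y i j
    have hFF : ∀ x, (F i * Y * F j) • x = v.coord j x • v.coord i (Y • v j) • v i := by
      intro x
      rw [mul_smul, hF j, smul_comm, mul_smul, hF i]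
    constructor
    · intro h0
      have := hFF (v j)
      rw [h0, zero_smul, Module.Basis.coord_apply, v.repr_self, Finsupp.single_eq_same,
        one_smul] at this
      exact (smul_eq_zero.1 this.symm).resolve_right (v.ne_zero i)
    · intro h0
      refine (map_eq_zero_iff _ hinj).1 (LinearMap.ext fun x => ?_)
      change (F i * Y * F j) • x = 0
      rw [hFF, h0, zero_smul, smul_zero]
  exact ⟨w, ws,
    { inj := hθ.1.1
      inj_star := hθs.1.1
      eig := hw
      eig_star := hws
      coord_eq_zero := fun i j hij => (key w Φ.E hE _ i j).1 (Φ.E_Astar_E_eq_zero i j hij)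
      coord_ne_zero := fun i j hij =>
        (key w Φ.E hE _ i j).not.1 (Φ.E_Astar_E_ne_zero i j hij)
      coord_star_eq_zero := fun i j hij =>
        (key ws Φ.Estar hEs _ i j).1 (Φ.Estar_A_Estar_eq_zero i j hij)
      coord_star_ne_zero := fun i j hij =>
        (key ws Φ.Estar hEs _ i j).not.1 (Φ.Estar_A_Estar_ne_zero i j hij) },
    hE, hEs⟩

theorem exists_isFirstSplitSequence [IsSimpleModule 𝒜 V]
    (h𝒜 : Nonempty (𝒜 ≃ₐ[K] Matrix (Fin (d + 1)) (Fin (d + 1)) K)) (Φ : LeonardSystem K 𝒜 d) :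
    ∃ φ : Fin d → K, Φ.IsFirstSplitSequence V φ := by
  obtain ⟨θ, hθ⟩ := Φ.ordering_E
  obtain ⟨θs, hθs⟩ := Φ.ordering_Estar
  obtain ⟨w, ws, hp, -, -⟩ := exists_isLeonardPair (V := V) h𝒜 Φ hθ hθs
  obtain ⟨φ, u, hu⟩ := hp.exists_isSplit
  exact ⟨φ, θ, θs, hθ, hθs, u, ⟨hu.raise, hu.raise_last, hu.lower, hu.lower_zero⟩⟩

theorem Down_isEigenvalueSequence {Φ : LeonardSystem K 𝒜 d} {θ : Fin (d + 1) → K}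
    (h : Φ.IsEigenvalueSequence θ) : Φ.Down.IsEigenvalueSequence fun i => θ i.rev :=
  IsIdempotentOrdering.rev h

/-- The four expressions for the first split sequence. -/
theorem IsFirstSplitSequence.eq_trace_ratios [IsSimpleModule 𝒜 V]
    (h𝒜 : Nonempty (𝒜 ≃ₐ[K] Matrix (Fin (d + 1)) (Fin (d + 1)) K)) {Φ : LeonardSystem K 𝒜 d}
    {θ θs : Fin (d + 1) → K} (hθ : Φ.IsEigenvalueSequence θ)
    (hθs : Φ.IsDualEigenvalueSequence θs) {φ : Fin d → K} (h : Φ.IsFirstSplitSequence V φ)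
    (j : Fin d) :
    (elementTrace K V (aeval Φ.A (tauPoly θ j) * Φ.Estar 0) ≠ 0 ∧
      φ j = (θs 0 - θs j.succ) *
        (elementTrace K V (aeval Φ.A (tauPoly θ (j + 1)) * Φ.Estar 0) /
          elementTrace K V (aeval Φ.A (tauPoly θ j) * Φ.Estar 0))) ∧
    (elementTrace K V (aeval Φ.A (etaPoly θ j.rev) * Φ.Estar (Fin.last d)) ≠ 0 ∧
      φ j = (θs (Fin.last d) - θs j.castSucc) *
        (elementTrace K V (aeval Φ.A (etaPoly θ (j.rev + 1)) * Φ.Estar (Fin.last d)) /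
          elementTrace K V (aeval Φ.A (etaPoly θ j.rev) * Φ.Estar (Fin.last d)))) ∧
    (elementTrace K V (aeval Φ.Astar (tauPoly θs j) * Φ.E 0) ≠ 0 ∧
      φ j = (θ 0 - θ j.succ) *
        (elementTrace K V (aeval Φ.Astar (tauPoly θs (j + 1)) * Φ.E 0) /
          elementTrace K V (aeval Φ.Astar (tauPoly θs j) * Φ.E 0))) ∧
    (elementTrace K V (aeval Φ.Astar (etaPoly θs j.rev) * Φ.E (Fin.last d)) ≠ 0 ∧
      φ j = (θ (Fin.last d) - θ j.castSucc) *
        (elementTrace K V (aeval Φ.Astar (etaPoly θs (j.rev + 1)) * Φ.E (Fin.last d)) /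
          elementTrace K V (aeval Φ.Astar (etaPoly θs j.rev) * Φ.E (Fin.last d)))) := by
  obtain ⟨θ', θs', hθ', hθs', u, hu⟩ := h
  obtain rfl : θ' = θ := IsIdempotentOrdering.eigenvalue_unique (V := V) h𝒜 hθ' hθ
  obtain rfl : θs' = θs := IsIdempotentOrdering.eigenvalue_unique (V := V) h𝒜 hθs' hθs
  obtain ⟨w, ws, hp, hE, hEs⟩ := exists_isLeonardPair (V := V) h𝒜 Φ hθ hθs
  have hs : IsSplit (Algebra.lsmul K K V Φ.A) (Algebra.lsmul K K V Φ.Astar) θ' θs' φ u :=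
    ⟨hu.A_smul, hu.A_smul_last, hu.Astar_smul, hu.Astar_smul_zero⟩
  have haeval : ∀ (Y : 𝒜) (p : K[X]) (x : V),
      aeval Y p • x = aeval (Algebra.lsmul K K V Y) p x := by
    intro Y p x
    rw [aeval_algHom_apply]
    rfl
  simp only [elementTrace_mul_eq_coord (hE _), elementTrace_mul_eq_coord (hEs _), haeval]
  exact ⟨hs.eq_ratio_tau hp j, hs.eq_ratio_eta hp j, hs.eq_ratio_tau_dual hp j,
    hs.eq_ratio_eta_dual hp j⟩

theorem IsFirstSplitSequence.unique [IsSimpleModule 𝒜 V]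
    (h𝒜 : Nonempty (𝒜 ≃ₐ[K] Matrix (Fin (d + 1)) (Fin (d + 1)) K)) {Φ : LeonardSystem K 𝒜 d}
    {φ φ' : Fin d → K} (h : Φ.IsFirstSplitSequence V φ) (h' : Φ.IsFirstSplitSequence V φ') :
    φ = φ' := by
  obtain ⟨θ, hθ⟩ := Φ.ordering_E
  obtain ⟨θs, hθs⟩ := Φ.ordering_Estar
  funext j
  rw [(h.eq_trace_ratios h𝒜 hθ hθs j).1.2, (h'.eq_trace_ratios h𝒜 hθ hθs j).1.2]

theorem existsUnique_isParameterArray [IsSimpleModule 𝒜 V]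
    (h𝒜 : Nonempty (𝒜 ≃ₐ[K] Matrix (Fin (d + 1)) (Fin (d + 1)) K)) (Φ : LeonardSystem K 𝒜 d) :
    ∃! p : LeonardArray K d, Φ.IsParameterArray V p := by
  obtain ⟨θ, hθ⟩ := Φ.ordering_E
  obtain ⟨θs, hθs⟩ := Φ.ordering_Estar
  obtain ⟨φ, hφ⟩ := exists_isFirstSplitSequence (V := V) h𝒜 Φ
  obtain ⟨ψ, hψ⟩ := exists_isFirstSplitSequence (V := V) h𝒜 Φ.Down
  refine ⟨⟨θ, θs, φ, ψ⟩, ⟨hθ, hθs, hφ, hψ⟩, ?_⟩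
  rintro ⟨θ', θs', φ', ψ'⟩ ⟨hθ', hθs', hφ', hψ'⟩
  obtain rfl : θ' = θ := IsIdempotentOrdering.eigenvalue_unique (V := V) h𝒜 hθ' hθ
  obtain rfl : θs' = θs := IsIdempotentOrdering.eigenvalue_unique (V := V) h𝒜 hθs' hθs
  obtain rfl : φ' = φ := hφ'.unique h𝒜 hφ
  obtain rfl : ψ' = ψ := hψ'.unique h𝒜 hψ
  rfl

end LeonardSystem

end System

theorem theorem4p6 {K : Type*} [Field K] {𝒜 : Type*} [Ring 𝒜] [Algebra K 𝒜] (d : ℕ)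
    (h𝒜 : Nonempty (𝒜 ≃ₐ[K] Matrix (Fin (d + 1)) (Fin (d + 1)) K))
    (V : Type*) [AddCommGroup V] [Module K V] [Module 𝒜 V] [IsScalarTower K 𝒜 V]
    [IsSimpleModule 𝒜 V] (Φ : LeonardSystem K 𝒜 d) :
    (∃! p : LeonardArray K d, Φ.IsParameterArray V p) ∧
    ∀ p : LeonardArray K d, Φ.IsParameterArray V p →
    ∀ (i : ℕ) (hi1 : 1 ≤ i) (hid : i ≤ d),
      (elementTrace K V (aeval Φ.A (tauPoly p.θ (i - 1)) * Φ.Estar 0) ≠ 0 ∧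
        p.varphi ⟨i - 1, by omega⟩ = (p.θstar 0 - p.θstar ⟨i, by omega⟩) *
          (elementTrace K V (aeval Φ.A (tauPoly p.θ i) * Φ.Estar 0) /
            elementTrace K V (aeval Φ.A (tauPoly p.θ (i - 1)) * Φ.Estar 0))) ∧
      (elementTrace K V (aeval Φ.A (etaPoly p.θ (d - i)) * Φ.Estar (Fin.last d)) ≠ 0 ∧
        p.varphi ⟨i - 1, by omega⟩ = (p.θstar (Fin.last d) - p.θstar ⟨i - 1, by omega⟩) *
          (elementTrace K V (aeval Φ.A (etaPoly p.θ (d - i + 1)) * Φ.Estar (Fin.last d)) /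
            elementTrace K V (aeval Φ.A (etaPoly p.θ (d - i)) * Φ.Estar (Fin.last d)))) ∧
      (elementTrace K V (aeval Φ.Astar (tauPoly p.θstar (i - 1)) * Φ.E 0) ≠ 0 ∧
        p.varphi ⟨i - 1, by omega⟩ = (p.θ 0 - p.θ ⟨i, by omega⟩) *
          (elementTrace K V (aeval Φ.Astar (tauPoly p.θstar i) * Φ.E 0) /
            elementTrace K V (aeval Φ.Astar (tauPoly p.θstar (i - 1)) * Φ.E 0))) ∧
      (elementTrace K V (aeval Φ.Astar (etaPoly p.θstar (d - i)) * Φ.E (Fin.last d)) ≠ 0 ∧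
        p.varphi ⟨i - 1, by omega⟩ = (p.θ (Fin.last d) - p.θ ⟨i - 1, by omega⟩) *
          (elementTrace K V (aeval Φ.Astar (etaPoly p.θstar (d - i + 1)) * Φ.E (Fin.last d)) /
            elementTrace K V (aeval Φ.Astar (etaPoly p.θstar (d - i)) * Φ.E (Fin.last d)))) ∧
      (elementTrace K V (aeval Φ.A (etaPoly p.θ (i - 1)) * Φ.Estar 0) ≠ 0 ∧
        p.phi ⟨i - 1, by omega⟩ = (p.θstar 0 - p.θstar ⟨i, by omega⟩) *
          (elementTrace K V (aeval Φ.A (etaPoly p.θ i) * Φ.Estar 0) /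
            elementTrace K V (aeval Φ.A (etaPoly p.θ (i - 1)) * Φ.Estar 0))) ∧
      (elementTrace K V (aeval Φ.A (tauPoly p.θ (d - i)) * Φ.Estar (Fin.last d)) ≠ 0 ∧
        p.phi ⟨i - 1, by omega⟩ = (p.θstar (Fin.last d) - p.θstar ⟨i - 1, by omega⟩) *
          (elementTrace K V (aeval Φ.A (tauPoly p.θ (d - i + 1)) * Φ.Estar (Fin.last d)) /
            elementTrace K V (aeval Φ.A (tauPoly p.θ (d - i)) * Φ.Estar (Fin.last d)))) ∧
      (elementTrace K V (aeval Φ.Astar (etaPoly p.θstar (d - i)) * Φ.E 0) ≠ 0 ∧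
        p.phi ⟨i - 1, by omega⟩ = (p.θ 0 - p.θ ⟨d - i + 1, by omega⟩) *
          (elementTrace K V (aeval Φ.Astar (etaPoly p.θstar (d - i + 1)) * Φ.E 0) /
            elementTrace K V (aeval Φ.Astar (etaPoly p.θstar (d - i)) * Φ.E 0))) ∧
      (elementTrace K V (aeval Φ.Astar (tauPoly p.θstar (i - 1)) * Φ.E (Fin.last d)) ≠ 0 ∧
        p.phi ⟨i - 1, by omega⟩ = (p.θ (Fin.last d) - p.θ ⟨d - i, by omega⟩) *
          (elementTrace K V (aeval Φ.Astar (tauPoly p.θstar i) * Φ.E (Fin.last d)) /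
            elementTrace K V (aeval Φ.Astar (tauPoly p.θstar (i - 1)) * Φ.E (Fin.last d)))) := by
  refine ⟨Φ.existsUnique_isParameterArray h𝒜, fun p hp i hi1 hid => ?_⟩
  obtain ⟨j, rfl⟩ : ∃ j : Fin d, i = (j : ℕ) + 1 := ⟨⟨i - 1, by omega⟩, by simp; omega⟩
  obtain ⟨h1, h2, h3, h4⟩ := hp.firstSplit.eq_trace_ratios h𝒜 hp.eigenvalue hp.dualEigenvalue j
  obtain ⟨h5, h6, h7, h8⟩ := hp.secondSplit.eq_trace_ratios h𝒜
    (LeonardSystem.Down_isEigenvalueSequence hp.eigenvalue)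
    (show Φ.Down.IsDualEigenvalueSequence p.θstar from hp.dualEigenvalue) j
  have hlast : Φ.Down.E (Fin.last d) = Φ.E 0 := congrArg Φ.E (Fin.rev_last d)
  have hzero : Φ.Down.E 0 = Φ.E (Fin.last d) := congrArg Φ.E (Fin.rev_zero d)
  have hcast : (⟨d - (j + 1) + 1, by omega⟩ : Fin (d + 1)) = j.rev.succ := by
    ext; simp [Fin.val_rev]
  have hsucc : (⟨d - (j + 1), by omega⟩ : Fin (d + 1)) = j.rev.castSucc := by
    ext; simp [Fin.val_rev]
  simp only [tauPoly_rev, etaPoly_rev, hlast, hzero, Fin.rev_last, Fin.rev_zero, Fin.rev_succ,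
    Fin.rev_castSucc] at h5 h6 h7 h8
  rw [Fin.val_rev] at h2 h4 h6 h8
  rw [hcast, hsucc]
  exact ⟨h1, h2, h3, h4, h5, h6, h8, h7⟩
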